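/- Graphs are finite (parallel edges are permitted; loops, if present, never belong to matchings). A matching is a set of pairwise disjoint edges; a maximum matching is one of greatest cardinality. A graph is factor-critical if for every vertex $v$ it has a matching that covers exactly the vertices other than $v$. An edge of a graph $G$ is allowed if it lies in some maximum matching of $G$. A factor-component of $G$ is a subgraph $G[C]$ of $G$ induced by the vertex set $C$ of a connected component of the spanning subgraph of $G$ whose edges are the allowed edges; let $\mathcal{G}(G)$ denote the set of factor-components of $G$. A set $X\subseteq V(G)$ is separating if it is a disjoint union of the vertex sets of one or more factor-components of $G$. For $H\in\mathcal{G}(G)$, a separating set $X$ is critical-inducing for $H$ if $V(H)\subseteq X$ and the graph $G[X]/V(H)$, obtained from the induced subgraph $G[X]$ by contracting $V(H)$ to a single vertex (and deleting the edges inside $V(H)$), is factor-critical. For $H,I\in\mathcal{G}(G)$, write $H\preceq I$ (the basilica order) if there is a critical-inducing set $X$ for $H$ with $V(I)\subseteq X$. **Theorem.** Let $G$ be a graph and let $H\in\mathcal{G}(G)$. Let $U^*(H)=\bigcup\{V(I) : I\in\mathcal{G}(G),\ H\preceq I\}$ be the set of all vertices contained in the upper bounds of $H$ in the basilica order ($H$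 itself included). Then $U^*(H)$ is the maximum critical-inducing set for $H$ with respect to inclusion; that is, the union of all the critical-inducing sets for $H$ is also a critical-inducing set for $H$, and it equals $U^*(H)$. -/

import Mathlib

open scoped Graph

namespace Basilica

variable {α β : Type*}

/-- A matching: a set of edges, any distinct two of which are disjoint. Loops, which do not join two
distinct vertices, never belong to a matching. -/
def IsMatching (G : Graph α β) (M : Set β) : Prop :=
  M ⊆ E(G) ∧ (∀ e ∈ M, ∀ x, ¬ G.IsLoopAt e x) ∧
    ∀ e ∈ M, ∀ f ∈ M, e ≠ f → ∀ x, ¬ (G.Inc e x ∧ G.Inc f x)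

/-- The edge set `M` covers the vertex `v`; if it does not, it exposes `v`. -/
def Covers (G : Graph α β) (M : Set β) (v : α) : Prop :=
  ∃ e ∈ M, G.Inc e v

/-- A maximum matching: a matching with the greatest cardinality. -/
def IsMaximumMatching (G : Graph α β) (M : Set β) : Prop :=
  IsMatching G M ∧ ∀ N, IsMatching G N → N.encard ≤ M.encard

/-- A near-perfect matching exposing `v`: a matching that covers all vertices except for `v`. -/
def IsNearPerfectMatchingExposing (G : Graph α β) (M : Set β) (v : α) : Prop :=
  IsMatching G M ∧ ¬ Covers G M v ∧ ∀ w ∈ V(G), w ≠ v → Covers G M w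

/-- A graph is factor-critical if every vertex is exposed by some near-perfect matching. -/
def IsFactorCritical (G : Graph α β) : Prop :=
  ∀ v ∈ V(G), ∃ M, IsNearPerfectMatchingExposing G M v

/-- An edge is allowed if some maximum matching contains it. -/
def IsAllowed (G : Graph α β) (e : β) : Prop :=
  ∃ M, IsMaximumMatching G M ∧ e ∈ M

/-- The spanning subgraph of `G` whose edges are the allowed edges. -/
def allowedSubgraph (G : Graph α β) : Graph α β :=
  G.restrict {e | IsAllowed G e}

/-- A factor-component of `G`: a subgraph of `G` induced by the vertex set of a connected component
of the spanning subgraph of allowed edges. -/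
def IsFactorComponent (G H : Graph α β) : Prop :=
  ∃ v ∈ V(G), H = G.induce {w | Relation.ReflTransGen (allowedSubgraph G).Adj v w}

open scoped Classical in
/-- The image of a vertex under the contraction of `X`: the vertices of `X` go to the new vertex
`none`, any other vertex `v` is kept as `some v`. -/
noncomputable def contractVertex (X : Set α) (v : α) : Option α :=
  if v ∈ X then none else some v

/-- The contraction `G / X`: its vertices are those outside `X` and the new vertex `none`; the edges
of `G[X]` are deleted and the ends in `X` of the other edges are replaced by the new vertex. -/
noncomputable def contract (G : Graph α β) (X : Set α) : Graph (Option α) β where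
  vertexSet := insert none (some '' (V(G) \ X))
  IsLink e a b := ∃ x y, G.IsLink e x y ∧ ¬ (x ∈ X ∧ y ∈ X) ∧
    a = contractVertex X x ∧ b = contractVertex X y
  isLink_symm := by
    intro e _
    refine ⟨?_⟩
    rintro a b ⟨x, y, h, hX, ha, hb⟩
    exact ⟨y, x, h.symm, fun h' => hX ⟨h'.2, h'.1⟩, hb, ha⟩
  eq_or_eq_of_isLink_of_isLink := by
    rintro e a b c d ⟨x, y, h, -, rfl, rfl⟩ ⟨x', y', h', -, rfl, rfl⟩
    rcases h.left_eq_or_eq h' with rfl | rfl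
    · exact Or.inl rfl
    · exact Or.inr rfl
  left_mem_of_isLink := by
    rintro e a b ⟨x, y, h, -, rfl, -⟩
    by_cases hx : x ∈ X
    · simp [contractVertex, hx]
    · simp [contractVertex, hx, h.left_mem]

/-- A separating set: a disjoint union of the vertex sets of finitely many, but at least one,
factor-components. -/
def IsSeparating (G : Graph α β) (X : Set α) : Prop :=
  ∃ S : Set (Graph α β), S.Finite ∧ S.Nonempty ∧ (∀ H ∈ S, IsFactorComponent G H) ∧
    S.PairwiseDisjoint Graph.vertexSet ∧ X = ⋃ H ∈ S, V(H)

/-- `X` is a critical-inducing set for the factor-component `H` of `G`: it is separating, contains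
`V(H)`, and `G[X] / H` is factor-critical. -/
def IsCriticalInducing (G H : Graph α β) (X : Set α) : Prop :=
  IsSeparating G X ∧ V(H) ⊆ X ∧ IsFactorCritical (contract (G.induce X) V(H))

/-- The basilica order between factor-components `H₁` and `H₂` of `G`: there is a critical-inducing
set for `H₁` that contains `V(H₂)`. -/
def BasilicaLE (G H₁ H₂ : Graph α β) : Prop :=
  ∃ X, IsCriticalInducing G H₁ X ∧ V(H₂) ⊆ X

/-- The set of all upper bounds of `H` in the basilica order, `H` itself included. -/
def upperBounds (G H : Graph α β) : Set (Graph α β) :=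
  {I | IsFactorComponent G I ∧ BasilicaLE G H I}

/-- The set of vertices contained in the upper bounds of `H`. -/
def upperVertices (G H : Graph α β) : Set α :=
  ⋃ I ∈ upperBounds G H, V(I)

end Basilica

/-! The heart is that the union of two critical-inducing sets X₁, X₂ for H is again one. A matching
of G[X₂]/H exposing the contracted vertex is a perfect matching N of X₂ \ V(H). That set is closed
under allowed edges, so an exchange with a maximum matching shows that every edge of N is allowed.
Hence N never crosses the boundary of X₁, and its edges outside X₁ match X₂ \ X₁ perfectly. They
extend any near-perfect matching of G[X₁]/H to one of G[X₁ ∪ X₂]/H with the same exposed vertex;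
vertices of X₂ are handled by symmetry (`IsCriticalInducing.union`). Since V(G) is finite, a maximal
critical-inducing set exists, and by the union property it contains all the others. -/

namespace Basilica

variable {α β : Type*} {G G' H I : Graph α β} {M N : Set β} {X X₁ X₂ Y : Set α}

/-! ### Matchings, covered vertices and cardinalities -/

section Matching

lemma isMatching_empty (G : Graph α β) : IsMatching G ∅ := by
  simp [IsMatching]

lemma IsMatching.subset (hM : IsMatching G M) (h : N ⊆ M) : IsMatching G N :=
  ⟨h.trans hM.1, fun e he => hM.2.1 e (h he), fun e he f hf => hM.2.2 e (h he) f (h hf)⟩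

lemma IsMatching.eq_of_inc (hM : IsMatching G M) {e f : β} {x : α} (he : e ∈ M) (hf : f ∈ M)
    (hex : G.Inc e x) (hfx : G.Inc f x) : e = f := by
  by_contra hne
  exact hM.2.2 e he f hf hne x ⟨hex, hfx⟩

lemma IsMatching.union (hM : IsMatching G M) (hN : IsMatching G N)
    (h : ∀ v, Covers G M v → ¬ Covers G N v) : IsMatching G (M ∪ N) := by
  refine ⟨Set.union_subset hM.1 hN.1, ?_, ?_⟩
  · rintro e (he | he)
    · exact hM.2.1 e he
    · exact hN.2.1 e he
  · rintro e (he | he) f (hf | hf) hne x ⟨hex, hfx⟩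
    · exact hM.2.2 e he f hf hne x ⟨hex, hfx⟩
    · exact h x ⟨e, he, hex⟩ ⟨f, hf, hfx⟩
    · exact h x ⟨f, hf, hfx⟩ ⟨e, he, hex⟩
    · exact hN.2.2 e he f hf hne x ⟨hex, hfx⟩

lemma IsMatching.mono (hle : G ≤ G') (hM : IsMatching G M) : IsMatching G' M := by
  refine ⟨hM.1.trans hle.edgeSet_mono, fun e he x hx => ?_, fun e he f hf hne x hx => ?_⟩
  · exact hM.2.1 e he x ((hle.isLoopAt_congr (hM.1 he)).2 hx)
  · exact hM.2.2 e he f hf hne x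
      ⟨(hle.inc_congr (hM.1 he)).2 hx.1, (hle.inc_congr (hM.1 hf)).2 hx.2⟩

lemma covers_congr (hle : G ≤ G') (hM : M ⊆ E(G)) (v : α) : Covers G' M v ↔ Covers G M v :=
  ⟨fun ⟨e, he, h⟩ => ⟨e, he, (hle.inc_congr (hM he)).2 h⟩,
    fun ⟨e, he, h⟩ => ⟨e, he, h.mono hle⟩⟩

lemma covers_union {v : α} : Covers G (M ∪ N) v ↔ Covers G M v ∨ Covers G N v := by
  simp [Covers, or_and_right, exists_or]

/-- Send each edge to one of its ends. Only the vertex set is assumed finite later on, so this is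
what bounds the size of a matching. -/
lemma IsMatching.exists_injective (hM : IsMatching G M) :
    ∃ f : M → V(G), Function.Injective f := by
  have h : ∀ e : M, ∃ x : V(G), G.Inc e x := fun e => by
    obtain ⟨x, y, hxy⟩ := Graph.exists_isLink_of_mem_edgeSet (hM.1 e.2)
    exact ⟨⟨x, hxy.left_mem⟩, hxy.inc_left⟩
  choose f hf using h
  refine ⟨f, fun a b hab => Subtype.ext (hM.eq_of_inc a.2 b.2 (hf a) ?_)⟩
  rw [hab]
  exact hf b

lemma IsMatching.finite (hM : IsMatching G M) (hG : V(G).Finite) : M.Finite := by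
  obtain ⟨f, hf⟩ := hM.exists_injective
  have := hG.to_subtype
  have := Finite.of_injective f hf
  exact Set.toFinite M

lemma IsMatching.ncard_le (hM : IsMatching G M) (hG : V(G).Finite) : M.ncard ≤ V(G).ncard := by
  obtain ⟨f, hf⟩ := hM.exists_injective
  have := hG.to_subtype
  rw [← Nat.card_coe_set_eq, ← Nat.card_coe_set_eq]
  exact Nat.card_le_card_of_injective f hf

/-- A finite matching covers exactly twice as many vertices as it has edges. -/
lemma IsMatching.encard_covers (hM : IsMatching G M) (hfin : M.Finite) :
    {v | Covers G M v}.encard = 2 * M.encard := by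
  induction M, hfin using Set.Finite.induction_on with
  | empty => simp [Covers]
  | @insert e M he _ ih =>
    have hM' := hM.subset (Set.subset_insert e M)
    obtain ⟨x, y, hxy⟩ := Graph.exists_isLink_of_mem_edgeSet (hM.1 (Set.mem_insert e M))
    have hne : x ≠ y := by
      rintro rfl
      exact hM.2.1 e (Set.mem_insert e M) x hxy
    have hcov : {v | Covers G (insert e M) v} = {x, y} ∪ {v | Covers G M v} := by
      ext v
      simp only [Set.mem_ofPred_eq, Set.mem_union, Set.mem_insert_iff, Set.mem_singleton_iff]
      rw [Set.insert_eq, covers_union]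
      refine or_congr_left ⟨?_, ?_⟩
      · rintro ⟨f, rfl, hf⟩
        exact hf.eq_or_eq_of_isLink hxy
      · rintro (rfl | rfl)
        · exact ⟨e, rfl, hxy.inc_left⟩
        · exact ⟨e, rfl, hxy.inc_right⟩
    have hdisj : Disjoint ({x, y} : Set α) {v | Covers G M v} := by
      rw [Set.disjoint_left]
      rintro v hv ⟨f, hf, hfv⟩
      have hev : G.Inc e v := by
        rcases hv with rfl | rfl
        · exact hxy.inc_left
        · exact hxy.inc_right
      have := hM.eq_of_inc (Set.mem_insert e M) (Set.mem_insert_of_mem e hf) hev hfv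
      exact he (this ▸ hf)
    rw [hcov, Set.encard_union_eq hdisj, Set.encard_pair hne, ih hM',
      Set.encard_insert_of_notMem he, mul_add, mul_one, add_comm]

lemma IsMatching.encard_le_of_covers (hG : V(G).Finite) (hM : IsMatching G M)
    (hN : IsMatching G N) (h : ∀ v, Covers G M v → Covers G N v) : M.encard ≤ N.encard := by
  have h2 : {v | Covers G M v}.encard ≤ {v | Covers G N v}.encard := Set.encard_le_encard h
  rw [hM.encard_covers (hM.finite hG), hN.encard_covers (hN.finite hG)] at h2
  rw [(hM.finite hG).encard_eq_coe_toFinset_card, (hN.finite hG).encard_eq_coe_toFinset_card] at *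
  norm_cast at *
  omega

lemma exists_isMaximumMatching (hG : V(G).Finite) : ∃ M, IsMaximumMatching G M := by
  let S : Set ℕ := {n | ∃ M, IsMatching G M ∧ M.ncard = n}
  have hbdd : BddAbove S := ⟨V(G).ncard, by rintro _ ⟨M, hM, rfl⟩; exact hM.ncard_le hG⟩
  obtain ⟨M, hM, hcard⟩ := Nat.sSup_mem (s := S) ⟨_, ∅, isMatching_empty G, rfl⟩ hbdd
  refine ⟨M, hM, fun N hN => ?_⟩
  rw [← (hM.finite hG).cast_ncard_eq, ← (hN.finite hG).cast_ncard_eq, hcard]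
  exact_mod_cast le_csSup hbdd ⟨N, hN, rfl⟩

end Matching

/-! ### Factor-components and sets closed under allowed edges -/

section FactorComponent

/-- A set of vertices is closed under allowed edges if no allowed edge leaves it. -/
def AllowedClosed (G : Graph α β) (X : Set α) : Prop :=
  ∀ ⦃e x y⦄, IsAllowed G e → G.IsLink e x y → x ∈ X → y ∈ X

lemma AllowedClosed.sdiff (hX : AllowedClosed G X) (hY : AllowedClosed G Y) :
    AllowedClosed G (X \ Y) :=
  fun _ _ _ he h hx => ⟨hX he h hx.1, fun hy => hx.2 (hY he h.symm hy)⟩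

lemma IsFactorComponent.allowedClosed (hH : IsFactorComponent G H) : AllowedClosed G V(H) := by
  obtain ⟨v, -, rfl⟩ := hH
  intro e x y he h hx
  exact Relation.ReflTransGen.tail hx ⟨e, by simp [allowedSubgraph, he, h]⟩

lemma IsFactorComponent.subset (hH : IsFactorComponent G H) : V(H) ⊆ V(G) := by
  obtain ⟨v, hv, rfl⟩ := hH
  intro w hw
  induction (hw : Relation.ReflTransGen _ v w) with
  | refl => exact hv
  | tail _ h _ => exact h.right_mem

lemma IsFactorComponent.eq_of_mem (hH : IsFactorComponent G H) (hI : IsFactorComponent G I)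
    {x : α} (hx : x ∈ V(H)) (hx' : x ∈ V(I)) : H = I := by
  obtain ⟨v, -, rfl⟩ := hH
  obtain ⟨w, -, rfl⟩ := hI
  have symm : ∀ {a b}, Relation.ReflTransGen (allowedSubgraph G).Adj a b →
      Relation.ReflTransGen (allowedSubgraph G).Adj b a := by
    intro a b h
    induction h with
    | refl => exact .refl
    | tail _ h ih => exact .head h.symm ih
  have hvw := Relation.ReflTransGen.trans hx (symm hx')
  congr 1
  ext u
  exact ⟨fun h => (symm hvw).trans h, fun h => hvw.trans h⟩

lemma pairwiseDisjoint_factorComponents (G : Graph α β) :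
    {H | IsFactorComponent G H}.PairwiseDisjoint Graph.vertexSet := by
  intro H hH I hI hne
  exact Set.disjoint_left.2 fun x hx hx' => hne (hH.eq_of_mem hI hx hx')

lemma IsFactorComponent.isSeparating (hH : IsFactorComponent G H) : IsSeparating G V(H) :=
  ⟨{H}, Set.finite_singleton H, Set.singleton_nonempty H, by simpa using hH, by simp, by simp⟩

lemma IsSeparating.subset (hX : IsSeparating G X) : X ⊆ V(G) := by
  obtain ⟨S, -, -, hS, -, rfl⟩ := hX
  exact Set.iUnion₂_subset fun H hH => (hS H hH).subset

lemma IsSeparating.allowedClosed (hX : IsSeparating G X) : AllowedClosed G X := by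
  obtain ⟨S, -, -, hS, -, rfl⟩ := hX
  intro e x y he h hx
  simp only [Set.mem_iUnion] at hx ⊢
  obtain ⟨I, hI, hxI⟩ := hx
  exact ⟨I, hI, (hS I hI).allowedClosed he h hxI⟩

lemma IsSeparating.union (h₁ : IsSeparating G X₁) (h₂ : IsSeparating G X₂) :
    IsSeparating G (X₁ ∪ X₂) := by
  obtain ⟨S, hSf, hSn, hS, -, rfl⟩ := h₁
  obtain ⟨T, hTf, -, hT, -, rfl⟩ := h₂
  have hST : ∀ H ∈ S ∪ T, IsFactorComponent G H := fun H hH => hH.elim (hS H) (hT H)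
  -- The two families may share members; disjointness survives because distinct factor-components
  -- are always disjoint.
  exact ⟨S ∪ T, hSf.union hTf, hSn.inl, hST, (pairwiseDisjoint_factorComponents G).subset hST,
    (Set.biUnion_union S T _).symm⟩

end FactorComponent

/-! ### Matchings in a contracted graph -/

section Contract

lemma contractVertex_of_mem {v : α} (hv : v ∈ X) : contractVertex X v = none := if_pos hv

lemma contractVertex_of_notMem {v : α} (hv : v ∉ X) : contractVertex X v = some v := if_neg hv

lemma contractVertex_eq_some {v w : α} : contractVertex X v = some w ↔ v = w ∧ w ∉ X := by
  by_cases hv : v ∈ X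
  · rw [contractVertex_of_mem hv]
    simp only [reduceCtorEq, false_iff]
    rintro ⟨rfl, h⟩
    exact h hv
  · rw [contractVertex_of_notMem hv, Option.some_inj]
    exact ⟨fun h => ⟨h, h ▸ hv⟩, And.left⟩

lemma contract_mono (hle : G ≤ G') (Y : Set α) : contract G Y ≤ contract G' Y := by
  refine ⟨Set.insert_subset_insert (Set.image_mono (Set.sdiff_subset_sdiff_left hle.1)), ?_⟩
  rintro e a b ⟨x, y, h, hY, ha, hb⟩
  exact ⟨x, y, h.mono hle, hY, ha, hb⟩

lemma contract_isLink_some {e : β} {x y : α} :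
    (contract G Y).IsLink e (some x) (some y) ↔ G.IsLink e x y ∧ x ∉ Y ∧ y ∉ Y := by
  constructor
  · rintro ⟨x', y', h, -, hx, hy⟩
    obtain ⟨rfl, hx⟩ := contractVertex_eq_some.1 hx.symm
    obtain ⟨rfl, hy⟩ := contractVertex_eq_some.1 hy.symm
    exact ⟨h, hx, hy⟩
  · rintro ⟨h, hx, hy⟩
    exact ⟨x, y, h, fun h' => hx h'.1, (contractVertex_of_notMem hx).symm,
      (contractVertex_of_notMem hy).symm⟩

lemma induce_mono_right (h : X₁ ⊆ X₂) : G.induce X₁ ≤ G.induce X₂ :=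
  ⟨h, fun _ _ _ h' => ⟨h'.1, h h'.2.1, h h'.2.2⟩⟩

/-- An edge set missing the contracted vertex lives entirely outside `Y`, where contraction changes
nothing; this lets matchings be pulled back to `G`. -/
lemma exists_isLink_of_not_covers_none (hM : M ⊆ E(contract G Y))
    (hnone : ¬ Covers (contract G Y) M none) {e : β} (he : e ∈ M) :
    ∃ x y, G.IsLink e x y ∧ x ∉ Y ∧ y ∉ Y ∧ (contract G Y).IsLink e (some x) (some y) := by
  obtain ⟨a, b, h⟩ := Graph.exists_isLink_of_mem_edgeSet (hM he)
  cases a with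
  | none => exact absurd ⟨e, he, h.inc_left⟩ hnone
  | some x =>
    cases b with
    | none => exact absurd ⟨e, he, h.inc_right⟩ hnone
    | some y =>
      have h' := contract_isLink_some.1 h
      exact ⟨x, y, h'.1, h'.2.1, h'.2.2, h⟩

lemma inc_iff_of_isLink {x y : α} {e : β} (h : G.IsLink e x y)
    (h' : (contract G Y).IsLink e (some x) (some y)) (v : α) :
    (contract G Y).Inc e (some v) ↔ G.Inc e v := by
  constructor
  · intro hv
    rcases hv.eq_or_eq_of_isLink h' with hv | hv
    · rw [Option.some_inj.1 hv]; exact h.inc_left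
    · rw [Option.some_inj.1 hv]; exact h.inc_right
  · intro hv
    rcases hv.eq_or_eq_of_isLink h with rfl | rfl
    · exact h'.inc_left
    · exact h'.inc_right

lemma IsMatching.of_contract (hM : IsMatching (contract G Y) M)
    (hnone : ¬ Covers (contract G Y) M none) : IsMatching G M := by
  have key : ∀ e ∈ M, ∀ v, (contract G Y).Inc e (some v) ↔ G.Inc e v := fun e he v => by
    obtain ⟨x, y, h, -, -, h'⟩ := exists_isLink_of_not_covers_none hM.1 hnone he
    exact inc_iff_of_isLink h h' v
  refine ⟨fun e he => ?_, fun e he v hv => ?_, fun e he f hf hne v hv => ?_⟩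
  · obtain ⟨x, y, h, -⟩ := exists_isLink_of_not_covers_none hM.1 hnone he
    exact h.edge_mem
  · obtain ⟨x, y, h, -, -, h'⟩ := exists_isLink_of_not_covers_none hM.1 hnone he
    have hx := hv.eq_of_inc h.inc_left
    have hy := hv.eq_of_inc h.inc_right
    subst hx hy
    exact hM.2.1 e he _ h'
  · exact hM.2.2 e he f hf hne (some v) ⟨(key e he v).2 hv.1, (key f hf v).2 hv.2⟩

lemma covers_of_contract (hM : M ⊆ E(contract G Y))
    (hnone : ¬ Covers (contract G Y) M none) (v : α) :
    Covers (contract G Y) M (some v) ↔ Covers G M v := by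
  refine exists_congr fun e => and_congr_right fun he => ?_
  obtain ⟨x, y, h, -, -, h'⟩ := exists_isLink_of_not_covers_none hM hnone he
  exact inc_iff_of_isLink h h' v

end Contract

/-! ### Unions of critical-inducing sets -/

section CriticalInducing

/-- A matching of `G` that covers exactly the vertices of a set closed under allowed edges
consists of allowed edges. -/
lemma IsMatching.isAllowed_of_covers_iff (hG : V(G).Finite) (hX : AllowedClosed G X)
    (hN : IsMatching G N) (hcov : ∀ v, Covers G N v ↔ v ∈ X) {e : β} (he : e ∈ N) :
    IsAllowed G e := by
  obtain ⟨M, hM⟩ := exists_isMaximumMatching hG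
  -- Exchange: inside `X` the maximum matching `M` is replaced by `N`. No edge of `M` crosses the
  -- boundary of `X`, so no covered vertex is lost and `M' ∪ N` is again maximum.
  set M' : Set β := {f ∈ M | ∀ v, G.Inc f v → v ∉ X}
  have hunion : IsMatching G (M' ∪ N) := by
    refine (hM.1.subset (Set.sep_subset _ _)).union hN ?_
    rintro v ⟨f, hf, hfv⟩ hv
    exact hf.2 v hfv ((hcov v).1 hv)
  have hle : M.encard ≤ (M' ∪ N).encard := by
    refine hM.1.encard_le_of_covers hG hunion ?_
    rintro v ⟨f, hf, w, hvw⟩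
    rw [covers_union]
    by_cases hv : v ∈ X
    · exact Or.inr ((hcov v).2 hv)
    · refine Or.inl ⟨f, ⟨hf, fun u hu => ?_⟩, hvw.inc_left⟩
      rcases hu.eq_or_eq_of_isLink hvw with rfl | rfl
      · exact hv
      · exact fun hu => hv (hX ⟨M, hM, hf⟩ hvw.symm hu)
  exact ⟨M' ∪ N, ⟨hunion, fun K hK => (hM.2 K hK).trans hle⟩, Or.inr he⟩

/-- A critical-inducing set minus its factor-component has a perfect matching that consists of
allowed edges. -/
lemma IsCriticalInducing.exists_isMatching (hG : V(G).Finite) (hH : IsFactorComponent G H)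
    (hX : IsCriticalInducing G H X) :
    ∃ N, IsMatching G N ∧ (∀ v, Covers G N v ↔ v ∈ X \ V(H)) ∧ ∀ e ∈ N, IsAllowed G e := by
  obtain ⟨hsep, -, hcrit⟩ := hX
  -- Exposing the contracted vertex leaves a matching that avoids `V(H)`.
  obtain ⟨N, hN, hnone, hcovN⟩ := hcrit none (Set.mem_insert _ _)
  have hNX : IsMatching (G.induce X) N := hN.of_contract hnone
  have hle : G.induce X ≤ G := Graph.induce_le hsep.subset
  have hcov : ∀ v, Covers G N v ↔ v ∈ X \ V(H) := by
    intro v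
    rw [covers_congr hle hNX.1, ← covers_of_contract hN.1 hnone]
    constructor
    · rintro ⟨e, -, he⟩
      rcases he.vertex_mem with h | ⟨w, hw, h⟩
      · cases h
      · rw [← Option.some_inj.1 h]
        exact hw
    · intro hv
      exact hcovN (some v) (Set.mem_insert_of_mem _ ⟨v, hv, rfl⟩) (Option.some_ne_none v)
  exact ⟨N, hNX.mono hle, hcov, fun e he => (hNX.mono hle).isAllowed_of_covers_iff hG
    (hsep.allowedClosed.sdiff hH.allowedClosed) hcov he⟩

/-- If `X₂ \ Y` has a perfect matching of allowed edges, then a near-perfect matching of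
`G[X₁] / Y` extends to one of `G[X₁ ∪ X₂] / Y` exposing the same vertex. -/
lemma exists_isNearPerfectMatchingExposing_union (hX₁ : AllowedClosed G X₁)
    (hN : IsMatching G N) (hcov : ∀ v, Covers G N v ↔ v ∈ X₂ \ Y)
    (hall : ∀ e ∈ N, IsAllowed G e) {a : Option α} (ha : a ∈ V(contract (G.induce X₁) Y))
    (hM : IsNearPerfectMatchingExposing (contract (G.induce X₁) Y) M a) :
    ∃ M', IsNearPerfectMatchingExposing (contract (G.induce (X₁ ∪ X₂)) Y) M' a := by
  obtain ⟨hM, hMa, hMcov⟩ := hM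
  have hle : contract (G.induce X₁) Y ≤ contract (G.induce (X₁ ∪ X₂)) Y :=
    contract_mono (induce_mono_right Set.subset_union_left) Y
  set K := contract (G.induce (X₁ ∪ X₂)) Y
  -- The part of `N` that will match `X₂ \ (X₁ ∪ Y)`.
  set N' : Set β := {e ∈ N | ∀ v, G.Inc e v → v ∉ X₁}
  have hlink : ∀ e ∈ N', ∃ x y, G.IsLink e x y ∧ K.IsLink e (some x) (some y) := by
    rintro e ⟨he, hout⟩
    obtain ⟨x, y, hxy⟩ := Graph.exists_isLink_of_mem_edgeSet (hN.1 he)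
    have hx := (hcov x).1 ⟨e, he, hxy.inc_left⟩
    have hy := (hcov y).1 ⟨e, he, hxy.inc_right⟩
    exact ⟨x, y, hxy, contract_isLink_some.2 ⟨⟨hxy, Or.inr hx.1, Or.inr hy.1⟩, hx.2, hy.2⟩⟩
  have hinc : ∀ e ∈ N', ∀ b, K.Inc e b → ∃ v, b = some v ∧ G.Inc e v := by
    intro e he b hb
    obtain ⟨x, y, h, h'⟩ := hlink e he
    rcases hb.eq_or_eq_of_isLink h' with rfl | rfl
    · exact ⟨x, rfl, h.inc_left⟩
    · exact ⟨y, rfl, h.inc_right⟩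
  have hN'K : IsMatching K N' := by
    refine ⟨fun e he => ?_, fun e he b hb => ?_, fun e he f hf hne b hb => ?_⟩
    · obtain ⟨x, y, -, h'⟩ := hlink e he
      exact h'.edge_mem
    · obtain ⟨x, y, h, h'⟩ := hlink e he
      have hx := hb.eq_of_inc h'.inc_left
      have hy := hb.eq_of_inc h'.inc_right
      have hxy : x = y := Option.some_inj.1 (hx.symm.trans hy)
      subst hxy
      exact hN.2.1 e he.1 x h
    · obtain ⟨v, rfl, hv⟩ := hinc e he b hb.1
      obtain ⟨w, hw, hfw⟩ := hinc f hf _ hb.2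
      rw [← Option.some_inj.1 hw] at hfw
      exact hN.2.2 e he.1 f hf.1 hne v ⟨hv, hfw⟩
  have hN'out : ∀ b, Covers K N' b → b ∉ V(contract (G.induce X₁) Y) := by
    rintro b ⟨e, he, hb⟩ hmem
    obtain ⟨v, rfl, hv⟩ := hinc e he b hb
    rcases hmem with h | ⟨w, hw, h⟩
    · cases h
    · exact he.2 v hv (Option.some_inj.1 h ▸ hw.1)
  refine ⟨M ∪ N', (hM.mono hle).union hN'K fun b hb hb' => ?_, ?_, fun b hb hne => ?_⟩
  · rw [covers_congr hle hM.1] at hb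
    obtain ⟨e, -, he⟩ := hb
    exact hN'out b hb' he.vertex_mem
  · rw [covers_union, covers_congr hle hM.1]
    rintro (h | h)
    · exact hMa h
    · exact hN'out a h ha
  · rw [covers_union, covers_congr hle hM.1]
    by_cases hbX : b ∈ V(contract (G.induce X₁) Y)
    · exact Or.inl (hMcov b hbX hne)
    · right
      rcases hb with rfl | ⟨v, ⟨hv, hvY⟩, rfl⟩
      · exact absurd (Set.mem_insert _ _) hbX
      · have hvX₁ : v ∉ X₁ := fun h => hbX (Set.mem_insert_of_mem _ ⟨v, ⟨h, hvY⟩, rfl⟩)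
        obtain ⟨e, he, w, hvw⟩ := (hcov v).2 ⟨hv.resolve_left hvX₁, hvY⟩
        have he' : e ∈ N' := by
          refine ⟨he, fun u hu => ?_⟩
          rcases hu.eq_or_eq_of_isLink hvw with rfl | rfl
          · exact hvX₁
          -- An allowed edge with one end in `X₁` has both ends there.
          · exact fun hu => hvX₁ (hX₁ (hall e he) hvw.symm hu)
        obtain ⟨x, y, h, h'⟩ := hlink e he'
        refine ⟨e, he', ?_⟩
        rcases hvw.inc_left.eq_or_eq_of_isLink h with rfl | rfl
        · exact h'.inc_left
        · exact h'.inc_right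

/-- The union of two critical-inducing sets for a factor-component is critical-inducing. -/
lemma IsCriticalInducing.union (hG : V(G).Finite) (hH : IsFactorComponent G H)
    (h₁ : IsCriticalInducing G H X₁) (h₂ : IsCriticalInducing G H X₂) :
    IsCriticalInducing G H (X₁ ∪ X₂) := by
  refine ⟨h₁.1.union h₂.1, h₁.2.1.trans Set.subset_union_left, fun a ha => ?_⟩
  have key : ∀ {Z₁ Z₂ : Set α}, IsCriticalInducing G H Z₁ → IsCriticalInducing G H Z₂ →
      a ∈ V(contract (G.induce Z₁) V(H)) →
      ∃ M, IsNearPerfectMatchingExposing (contract (G.induce (Z₁ ∪ Z₂)) V(H)) M a := by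
    intro Z₁ Z₂ hZ₁ hZ₂ ha
    obtain ⟨N, hN, hcov, hall⟩ := hZ₂.exists_isMatching hG hH
    obtain ⟨M, hM⟩ := hZ₁.2.2 a ha
    exact exists_isNearPerfectMatchingExposing_union hZ₁.1.allowedClosed hN hcov hall ha hM
  -- The exposed vertex decides which of the two sets supplies the near-perfect matching and which
  -- one the extension.
  rcases ha with rfl | ⟨v, ⟨hv | hv, hvH⟩, rfl⟩
  · exact key h₁ h₂ (Set.mem_insert _ _)
  · exact key h₁ h₂ (Set.mem_insert_of_mem _ ⟨v, ⟨hv, hvH⟩, rfl⟩)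
  · rw [Set.union_comm]
    exact key h₂ h₁ (Set.mem_insert_of_mem _ ⟨v, ⟨hv, hvH⟩, rfl⟩)

lemma IsFactorComponent.isCriticalInducing (hH : IsFactorComponent G H) :
    IsCriticalInducing G H V(H) := by
  refine ⟨hH.isSeparating, subset_rfl, fun a ha => ⟨∅, isMatching_empty _, by simp [Covers], ?_⟩⟩
  -- The contraction has a single vertex, so the empty matching suffices.
  have hV : V(contract (G.induce V(H)) V(H)) = {none} := by simp [contract]
  rw [hV] at ha ⊢
  intro b hb hne
  exact absurd (hb.trans ha.symm) hne

lemma isCriticalInducing_sUnion (hG : V(G).Finite) (hH : IsFactorComponent G H) :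
    IsCriticalInducing G H (⋃₀ {X | IsCriticalInducing G H X}) := by
  have hfin : {X | IsCriticalInducing G H X}.Finite :=
    hG.finite_subsets.subset fun X hX => hX.1.subset
  -- The union of a maximal `X` with any other critical-inducing set is again critical-inducing, so
  -- `X` absorbs it.
  obtain ⟨X, hX, hmax⟩ := hfin.exists_maximal ⟨V(H), hH.isCriticalInducing⟩
  have : ⋃₀ {X | IsCriticalInducing G H X} = X :=
    (Set.sUnion_subset fun Z hZ => Set.subset_union_right.trans
      (hmax (IsCriticalInducing.union hG hH hX hZ) Set.subset_union_left)).antisymm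
      (Set.subset_sUnion_of_mem hX)
  rwa [this]

lemma sUnion_isCriticalInducing_eq (G H : Graph α β) :
    ⋃₀ {X | IsCriticalInducing G H X} = upperVertices G H := by
  ext x
  simp only [upperVertices, upperBounds, Set.mem_sUnion, Set.mem_iUnion, Set.mem_ofPred_eq]
  constructor
  · rintro ⟨X, hX, hx⟩
    obtain ⟨S, -, -, hS, -, hXS⟩ := hX.1
    have hx' := hx
    rw [hXS] at hx'
    simp only [Set.mem_iUnion] at hx'
    obtain ⟨I, hI, hxI⟩ := hx'
    exact ⟨I, ⟨hS I hI, X, hX, hXS ▸ Set.subset_biUnion_of_mem (u := Graph.vertexSet) hI⟩, hxI⟩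
  · rintro ⟨I, ⟨-, X, hX, hIX⟩, hx⟩
    exact ⟨X, hX, hIX hx⟩

end CriticalInducing

end Basilica

theorem mainTheorem4 {α β : Type*} (G : Graph α β) (hG : V(G).Finite)
    (H : Graph α β) (hH : Basilica.IsFactorComponent G H) :
    Basilica.IsCriticalInducing G H (⋃₀ {X | Basilica.IsCriticalInducing G H X}) ∧
      ⋃₀ {X | Basilica.IsCriticalInducing G H X} = Basilica.upperVertices G H ∧
      IsGreatest {X | Basilica.IsCriticalInducing G H X} (Basilica.upperVertices G H) := by
  have hcrit := Basilica.isCriticalInducing_sUnion hG hH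
  have heq := Basilica.sUnion_isCriticalInducing_eq G H
  exact ⟨hcrit, heq, heq ▸ hcrit, fun X hX => heq ▸ Set.subset_sUnion_of_mem hX⟩
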